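/- A graphon is a measurable symmetric function $W:[0,1]^2\to[0,1]$. For a finite simple graph $F$ with vertex set $V(F)\neq\emptyset$, edge set $E(F)$ and $\mathrm{v}(F)=|V(F)|$, let $$t(F,W)=\int_{[0,1]^{V(F)}}\prod_{\{i,j\}\in E(F)}W(x_i,x_j)\prod_{i\in V(F)}dx_i,$$ and for a finite simple graph $G$ with at least one vertex let $t(F,G)=\hom(F,G)/|V(G)|^{|V(F)|}$, where $\hom(F,G)$ is the number of graph homomorphisms from $F$ to $G$. The $W$-random graph $\mathbb{G}(n,W)$ is the random simple graph on $\{1,\dots,n\}$ obtained by drawing $u_1,\dots,u_n$ independently and uniformly from $[0,1]$ and then, given $u_1,\dots,u_n$, joining each pair $i<j$ by an edge independently with probability $W(u_i,u_j)$. Theorem 2. Let $W_{\mathcal G}$ and $W_{\mathcal H}$ be graphons, $\lambda\in[0,1]$, and let $W_{\mathcal I}=\lambda W_{\mathcal G}+(1-\lambda)W_{\mathcal H}$ be the mixed graphon. Let $n\ge 1$, $0<\varepsilon<1$, and let $F_{\mathcal I}$ be a finite simple graph with at least one vertex (the motif). Then the $W_{\mathcal I}$-random graph $\mathbb{G}=\mathbb{G}(n,W_{\mathcal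 I})$ satisfies $$\mathrm{P}\bigl(|t(F_{\mathcal I},\mathbb{G})-t(F_{\mathcal I},W_{\mathcal I})|>\varepsilon\bigr)\le 2\exp\left(-\frac{\varepsilon^2 n}{8\,\mathrm{v}(F_{\mathcal I})^2}\right).$$ -/

import Mathlib

open MeasureTheory ProbabilityTheory

noncomputable section

/-- A graphon: a measurable symmetric function `W : [0,1]² → [0,1]`. -/
structure Graphon where
  toFun : unitInterval → unitInterval → unitInterval
  measurable' : Measurable (Function.uncurry toFun)
  symm' : ∀ x y, toFun x y = toFun y x

namespace Graphon

/-- The mixed graphon `lam * W₁ + (1 - lam) * W₂`. -/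
def mix (lam : unitInterval) (W₁ W₂ : Graphon) : Graphon where
  toFun x y := ⟨lam * (W₁.toFun x y : ℝ) + (1 - lam) * (W₂.toFun x y : ℝ), by
    have h := (convex_Icc (0 : ℝ) 1) (W₁.toFun x y).2 (W₂.toFun x y).2 lam.2.1
      (sub_nonneg.2 lam.2.2) (by ring)
    simpa only [smul_eq_mul] using h⟩
  measurable' := by
    refine Measurable.subtype_mk ?_
    exact ((measurable_subtype_coe.comp W₁.measurable').const_mul _).add
      ((measurable_subtype_coe.comp W₂.measurable').const_mul _)
  symm' x y := by
    apply Subtype.ext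
    simp only [W₁.symm' x y, W₂.symm' x y]

/-- For points `x v ∈ [0,1]` attached to the vertices, the weight `W (x i) (x j)` of the
unordered pair `{i, j}`. -/
def edgeWeight (W : Graphon) {V : Type*} (x : V → unitInterval) : Sym2 V → unitInterval :=
  Sym2.lift ⟨fun i j => W.toFun (x i) (x j), fun i j => W.symm' (x i) (x j)⟩

lemma measurable_edgeWeight (W : Graphon) {V : Type*} (e : Sym2 V) :
    Measurable fun x : V → unitInterval => W.edgeWeight x e := by
  induction e using Sym2.inductionOn with
  | hf i j =>
    have h : Measurable fun x : V → unitInterval => (x i, x j) :=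
      (measurable_pi_apply i).prodMk (measurable_pi_apply j)
    exact W.measurable'.comp h

open Classical in
/-- The homomorphism density `t(F, W) = ∫_{[0,1]^{V(F)}} ∏_{ij ∈ E(F)} W(x_i, x_j) dx`. -/
def homDensity {V : Type*} [Fintype V] (F : SimpleGraph V) (W : Graphon) : ℝ :=
  ∫ x : V → unitInterval, ∏ e ∈ F.edgeFinset, (W.edgeWeight x e : ℝ)

/-- The law of the random simple graph on `Fin n` given the points `u`: the pairs `{i, j}` are
edges independently with probability `W (u i) (u j)`
(`SimpleGraph.fromEdgeSet` discards the loops `i = j`). -/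
def condLaw (W : Graphon) (n : ℕ) (u : Fin n → unitInterval) : Measure (SimpleGraph (Fin n)) :=
  (Measure.pi fun e : Sym2 (Fin n) => bernoulliMeasure True False (W.edgeWeight u e)).map
    fun ω => SimpleGraph.fromEdgeSet {e | ω e}

/-- The law of the `W`-random graph `𝔾(n, W)`: the points `u i` are i.i.d. uniform on `[0,1]`,
and given the points the graph has law `W.condLaw n u`. -/
def randomGraph (W : Graphon) (n : ℕ) : Measure (SimpleGraph (Fin n)) :=
  (Measure.pi fun _ : Fin n => (volume : Measure unitInterval)).bind (W.condLaw n)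

lemma measurable_toGraph (n : ℕ) : Measurable
    fun ω : Sym2 (Fin n) → Prop => SimpleGraph.fromEdgeSet {e | ω e} :=
  measurable_of_countable _

lemma measurable_condLaw (W : Graphon) (n : ℕ) : Measurable (W.condLaw n) := by
  refine (Measure.measurable_map _ (measurable_toGraph n)).comp ?_
  refine Measure.measurable_of_measurable_coe _ fun S _ => ?_
  have key : ∀ u : Fin n → unitInterval,
      (Measure.pi fun e : Sym2 (Fin n) => bernoulliMeasure True False (W.edgeWeight u e)) S
        = ∑ ω ∈ S.toFinite.toFinset, ∏ e, bernoulliMeasure True False (W.edgeWeight u e) {ω e} := by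
    intro u
    conv_lhs => rw [← S.toFinite.coe_toFinset, ← sum_measure_singleton]
    simp only [Measure.pi_singleton]
  simp_rw [key]
  refine Finset.measurable_sum _ fun ω _ => Finset.measurable_prod _ fun e _ => ?_
  have h1 : Measurable fun p : unitInterval =>
      bernoulliMeasure True False p ({ω e} : Set Prop) := by
    simp only [bernoulliMeasure_def, Measure.add_apply, Measure.smul_apply, ENNReal.smul_def,
      smul_eq_mul]
    have h2 : Measurable fun p : unitInterval => (unitInterval.toNNReal p : ENNReal) :=
      (ENNReal.continuous_coe.comp unitInterval.toNNReal_continuous).measurable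
    exact (h2.mul_const _).add
      ((h2.comp unitInterval.continuous_symm.measurable).mul_const _)
  exact h1.comp (W.measurable_edgeWeight e)

instance (W : Graphon) (n : ℕ) (u : Fin n → unitInterval) :
    IsProbabilityMeasure (W.condLaw n u) :=
  Measure.isProbabilityMeasure_map (measurable_toGraph n).aemeasurable

instance (W : Graphon) (n : ℕ) : IsProbabilityMeasure (W.randomGraph n) := by
  constructor
  rw [randomGraph, Measure.bind_apply MeasurableSet.univ (W.measurable_condLaw n).aemeasurable]
  simp

end Graphon

/-- The homomorphism density `t(F, G) = hom(F, G) / v(G) ^ v(F)` of finite simple graphs. -/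
def SimpleGraph.homDensity {V V' : Type*} [Fintype V] [Fintype V'] (F : SimpleGraph V)
    (G : SimpleGraph V') : ℝ :=
  (Nat.card (F →g G) : ℝ) / (Fintype.card V' : ℝ) ^ Fintype.card V

end

/-! The argument works for an arbitrary graphon `W`; let `k` be the number of vertices of the motif.
The random graph is a function of `n` i.i.d. latent variables, one per vertex: the point `u i` and a
row of uniform coins. The coin deciding a pair is read from the row of its larger endpoint, so
resampling the variable of vertex `i` only affects edges at `i` (`randomGraph_eq_map`,
`latentGraph_adj_congr`).

At most `k * n ^ (k - 1)` vertex maps hit a given vertex, so such a change moves the density by at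
most `k / n`, and McDiarmid's inequality gives concentration about the mean. An injective map is a
homomorphism with probability exactly `t(F, W)`, and at most `k ^ 2 * n ^ (k - 1)` maps are not
injective, so the mean is within `k ^ 2 / n` of `t(F, W)`. If this bias is at most `ε / 2`,
McDiarmid at `ε / 2` suffices; otherwise `n` is so small that the claimed bound exceeds `1`. -/

namespace ProbabilityTheory

/-! ### McDiarmid's inequality. -/

/-- Changing a single coordinate of the argument changes the value of `f` by at most `c`. -/
def HasBoundedDifferences {ι X : Type*} (f : (ι → X) → ℝ) (c : NNReal) : Prop :=
  ∀ i x y, (∀ j, j ≠ i → x j = y j) → |f x - f y| ≤ c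

lemma HasBoundedDifferences.cons {X : Type*} {n : ℕ} {f : (Fin (n + 1) → X) → ℝ} {c : NNReal}
    (hf : HasBoundedDifferences f c) (a : X) :
    HasBoundedDifferences (fun y : Fin n → X => f (Fin.cons a y)) c := by
  intro i x y hxy
  refine hf i.succ _ _ fun j hj => ?_
  induction j using Fin.cases with
  | zero => rfl
  | succ j => exact hxy j fun h => hj (h ▸ rfl)

lemma HasBoundedDifferences.abs_sub_cons_le {X : Type*} {n : ℕ} {f : (Fin (n + 1) → X) → ℝ}
    {c : NNReal} (hf : HasBoundedDifferences f c) (a b : X) (y : Fin n → X) :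
    |f (Fin.cons a y) - f (Fin.cons b y)| ≤ c := by
  refine hf 0 _ _ fun j hj => ?_
  induction j using Fin.cases with
  | zero => exact absurd rfl hj
  | succ j => rfl

lemma HasBoundedDifferences.abs_sub_le {X : Type*} {n : ℕ} {f : (Fin n → X) → ℝ} {c : NNReal}
    (hf : HasBoundedDifferences f c) (x y : Fin n → X) : |f x - f y| ≤ n * c := by
  induction n with
  | zero => simp [Subsingleton.elim x y]
  | succ n ih =>
    have h1 := ih (hf.cons (x 0)) (Fin.tail x) (Fin.tail y)
    have h2 := hf.abs_sub_cons_le (x 0) (y 0) (Fin.tail y)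
    simp only [Fin.cons_self_tail] at h1 h2
    have h3 := _root_.abs_sub_le (f x) (f (Fin.cons (x 0) (Fin.tail y))) (f y)
    push_cast
    linarith

lemma HasBoundedDifferences.exists_bound {X : Type*} {n : ℕ} {f : (Fin n → X) → ℝ} {c : NNReal}
    (hf : HasBoundedDifferences f c) : ∃ C, ∀ x, |f x| ≤ C := by
  rcases isEmpty_or_nonempty (Fin n → X) with h | ⟨⟨x₀⟩⟩
  · exact ⟨0, fun x => h.elim x⟩
  · refine ⟨n * c + |f x₀|, fun x => ?_⟩
    have h1 := hf.abs_sub_le x x₀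
    have h2 := abs_sub_abs_le_abs_sub (f x) (f x₀)
    linarith

/-- Averaging against a probability measure cannot enlarge a uniform bound on differences. This lets
the induction in McDiarmid's inequality pass to the conditional mean. -/
lemma HasBoundedDifferences.integral_cons {X : Type*} [MeasurableSpace X] {μ : Measure X}
    [IsProbabilityMeasure μ] {n : ℕ} {f : (Fin (n + 1) → X) → ℝ} {c : NNReal}
    (hf : HasBoundedDifferences f c)
    (hint : ∀ y : Fin n → X, Integrable (fun a => f (Fin.cons a y)) μ) :
    HasBoundedDifferences (fun y : Fin n → X => ∫ a, f (Fin.cons a y) ∂μ) c := by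
  intro i x y hxy
  rw [← integral_sub (hint x) (hint y), ← Real.norm_eq_abs]
  refine (norm_integral_le_of_norm_le_const (C := (c : ℝ)) (.of_forall fun a => ?_)).trans_eq
    (by simp)
  exact hf.cons a i x y hxy

/-- Hoeffding's lemma for a function of oscillation at most `c`. -/
lemma hasSubgaussianMGF_of_abs_sub_le {X : Type*} [MeasurableSpace X] {μ : Measure X}
    [IsProbabilityMeasure μ] {f : X → ℝ} {c : NNReal} (hm : Measurable f)
    (hf : ∀ x y, |f x - f y| ≤ c) :
    HasSubgaussianMGF (fun x => f x - ∫ a, f a ∂μ) ((c / 2) ^ 2) μ := by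
  have hne : Nonempty X := μ.nonempty_of_neZero
  obtain ⟨x₀⟩ := hne
  have hbdd : BddBelow (Set.range f) :=
    ⟨f x₀ - c, by rintro _ ⟨x, rfl⟩; linarith [(abs_le.1 (hf x₀ x)).2]⟩
  -- Oscillation at most `c` puts the range in an interval of length `c` starting at the infimum.
  have h := hasSubgaussianMGF_of_mem_Icc (μ := μ) (X := f) (a := ⨅ x, f x) (b := (⨅ x, f x) + c)
    hm.aemeasurable (.of_forall fun x => ⟨ciInf_le hbdd x, ?_⟩)
  · simpa using h
  · have : f x - c ≤ ⨅ x, f x :=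
      have : Nonempty X := ⟨x₀⟩
      le_ciInf fun y => by linarith [(abs_le.1 (hf x y)).2]
    linarith

/-- McDiarmid's inequality in moment generating function form: a function of `n` independent
variables with bounded differences `c` is sub-Gaussian with variance proxy `n * (c / 2) ^ 2`. -/
theorem HasBoundedDifferences.hasSubgaussianMGF {X : Type*} [MeasurableSpace X] {μ : Measure X}
    [IsProbabilityMeasure μ] {n : ℕ} {f : (Fin n → X) → ℝ} {c : NNReal} (hm : Measurable f)
    (hf : HasBoundedDifferences f c) :
    HasSubgaussianMGF (fun x => f x - ∫ y, f y ∂(Measure.pi fun _ : Fin n => μ))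
      (n * (c / 2) ^ 2) (Measure.pi fun _ : Fin n => μ) := by
  induction n with
  | zero =>
    have h : (fun x => f x - ∫ y, f y ∂(Measure.pi fun _ : Fin 0 => μ)) = fun _ => 0 := by
      funext x
      rw [integral_congr_ae (.of_forall fun y => congrArg f (Subsingleton.elim y x))]
      simp
    rw [h]
    simp
  | succ n ih =>
    obtain ⟨C, hC⟩ := hf.exists_bound
    have hcons : Measurable fun p : X × (Fin n → X) => (Fin.cons p.1 p.2 : Fin (n + 1) → X) := by
      refine measurable_pi_lambda _ fun j => ?_
      induction j using Fin.cases with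
      | zero => simpa using measurable_fst
      | succ j => exact (measurable_pi_apply j).comp measurable_snd
    have hmp : Measurable fun p : X × (Fin n → X) => f (Fin.cons p.1 p.2) := hm.comp hcons
    have hsec (y : Fin n → X) : Measurable fun a => f (Fin.cons a y) :=
      hmp.comp measurable_prodMk_right
    have hsecint (y : Fin n → X) : Integrable (fun a => f (Fin.cons a y)) μ :=
      .of_bound (hsec y).aestronglyMeasurable C (.of_forall fun a => hC _)
    set g : (Fin n → X) → ℝ := fun y => ∫ a, f (Fin.cons a y) ∂μ with hg
    have hgm : Measurable g :=
      (StronglyMeasurable.integral_prod_left' (f := fun p : X × (Fin n → X) => f (Fin.cons p.1 p.2))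
        hmp.stronglyMeasurable).measurable
    have hgsub := ih hgm (hf.integral_cons hsecint)
    -- Fubini, splitting off coordinate `0`; boundedness supplies the integrability.
    have htransfer (h : (Fin (n + 1) → X) → ℝ) (hh : Measurable h) (D : ℝ) (hD : ∀ x, |h x| ≤ D) :
        ∫ x, h x ∂(Measure.pi fun _ => μ)
          = ∫ y, ∫ a, h (Fin.cons a y) ∂μ ∂(Measure.pi fun _ : Fin n => μ) := by
      have hmap := (measurePreserving_piFinSuccAbove (fun _ : Fin (n + 1) => μ) 0).symm
      rw [← hmap.integral_comp' h, integral_prod_symm]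
      · simp [MeasurableEquiv.piFinSuccAbove_symm_apply, Fin.insertNthEquiv]
      · exact .of_bound (hh.comp (MeasurableEquiv.measurable _)).aestronglyMeasurable D
          (.of_forall fun p => hD _)
    have hmean : ∫ x, f x ∂(Measure.pi fun _ => μ) = ∫ y, g y ∂(Measure.pi fun _ => μ) :=
      htransfer f hm C hC
    rw [hmean]
    set m := ∫ y, g y ∂(Measure.pi fun _ : Fin n => μ) with hmdef
    have hexpm (t : ℝ) : Measurable fun x => Real.exp (t * (f x - m)) :=
      ((hm.sub_const m).const_mul t).exp
    have hexpb (t : ℝ) (x : Fin (n + 1) → X) :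
        |Real.exp (t * (f x - m))| ≤ Real.exp (|t| * (C + |m|)) := by
      rw [Real.abs_exp, Real.exp_le_exp]
      refine (le_abs_self _).trans ?_
      rw [abs_mul]
      gcongr
      exact (abs_sub _ _).trans (by gcongr; exact hC x)
    refine ⟨fun t => .of_bound (hexpm t).aestronglyMeasurable _ (.of_forall (hexpb t)), fun t => ?_⟩
    rw [mgf, htransfer _ (hexpm t) _ (hexpb t)]
    -- With the other coordinates frozen, `f` has mean `g y` and oscillation at most `c`, so
    -- Hoeffding's lemma contributes one factor with proxy `(c / 2) ^ 2`.
    have hinner (y : Fin n → X) : ∫ a, Real.exp (t * (f (Fin.cons a y) - m)) ∂μ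
        ≤ Real.exp (t * (g y - m)) * Real.exp (((c / 2 : NNReal) ^ 2 : NNReal) * t ^ 2 / 2) := by
      have h1 := (hasSubgaussianMGF_of_abs_sub_le (μ := μ) (hsec y)
        fun a b => hf.abs_sub_cons_le a b y).mgf_le t
      calc ∫ a, Real.exp (t * (f (Fin.cons a y) - m)) ∂μ
          = ∫ a, Real.exp (t * (g y - m)) * Real.exp (t * (f (Fin.cons a y) - g y)) ∂μ := by
            congr 1 with a
            rw [← Real.exp_add]
            ring_nf
        _ = Real.exp (t * (g y - m)) * mgf (fun a => f (Fin.cons a y) - g y) μ t :=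
            integral_const_mul _ _
        _ ≤ _ := by gcongr
    calc ∫ y, ∫ a, Real.exp (t * (f (Fin.cons a y) - m)) ∂μ ∂(Measure.pi fun _ : Fin n => μ)
        ≤ ∫ y, Real.exp (t * (g y - m)) * Real.exp (((c / 2 : NNReal) ^ 2 : NNReal) * t ^ 2 / 2)
            ∂(Measure.pi fun _ : Fin n => μ) := by
          refine integral_mono_of_nonneg
            (.of_forall fun y => integral_nonneg fun a => (Real.exp_pos _).le)
            ((hgsub.integrable_exp_mul t).mul_const _) (.of_forall hinner)
      _ = mgf (fun y => g y - m) (Measure.pi fun _ : Fin n => μ) t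
            * Real.exp (((c / 2 : NNReal) ^ 2 : NNReal) * t ^ 2 / 2) := integral_mul_const _ _
      _ ≤ Real.exp ((n * (c / 2) ^ 2 : NNReal) * t ^ 2 / 2)
            * Real.exp (((c / 2 : NNReal) ^ 2 : NNReal) * t ^ 2 / 2) := by
          gcongr
          exact hgsub.mgf_le t
      _ = _ := by
          rw [← Real.exp_add]
          push_cast
          ring_nf

/-- Two-sided McDiarmid inequality. -/
theorem HasBoundedDifferences.measureReal_abs_sub_integral_ge_le {X : Type*} [MeasurableSpace X]
    {μ : Measure X} [IsProbabilityMeasure μ] {n : ℕ} {f : (Fin n → X) → ℝ} {c : NNReal}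
    (hm : Measurable f) (hf : HasBoundedDifferences f c) {ε : ℝ} (hε : 0 ≤ ε) :
    (Measure.pi fun _ : Fin n => μ).real
        {x | ε ≤ |f x - ∫ y, f y ∂(Measure.pi fun _ : Fin n => μ)|}
      ≤ 2 * Real.exp (-(2 * ε ^ 2 / (n * c ^ 2))) := by
  have h := hf.hasSubgaussianMGF (μ := μ) hm
  set X' := fun x => f x - ∫ y, f y ∂(Measure.pi fun _ : Fin n => μ) with hX'
  have hexp : Real.exp (-ε ^ 2 / (2 * (n * (c / 2) ^ 2 : NNReal)))
      = Real.exp (-(2 * ε ^ 2 / (n * c ^ 2))) := by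
    congr 1
    push_cast
    -- In the degenerate case both exponents are divisions by zero, hence `0`.
    rcases eq_or_ne ((n : ℝ) * c ^ 2) 0 with h0 | h0
    · have : (n : ℝ) * ((c : ℝ) / 2) ^ 2 = 0 := by linear_combination h0 / 4
      rw [h0, this]
      simp
    · have : (2 : ℝ) * (n * ((c : ℝ) / 2) ^ 2) = (n * c ^ 2) / 2 := by ring
      rw [this]
      field_simp
  have h1 := h.measure_ge_le hε
  have h2 := h.neg.measure_ge_le hε
  rw [hexp] at h1 h2
  have hsub : {x | ε ≤ |X' x|} ⊆ {x | ε ≤ X' x} ∪ {x | ε ≤ (-X') x} := fun x hx => by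
    rcases le_abs.1 (show ε ≤ |X' x| from hx) with h | h
    · exact Or.inl h
    · exact Or.inr h
  calc _ ≤ _ := measureReal_mono hsub
    _ ≤ _ := measureReal_union_le _ _
    _ ≤ _ := by linarith

end ProbabilityTheory

/-! ### Reindexing and selection in product measures. -/

namespace MeasureTheory

/-- Reindexing along an injection maps a product of copies of `μ` to a product of copies of `μ`. -/
lemma measurePreserving_comp_injective {ι κ X : Type*} [Fintype ι] [Fintype κ]
    [MeasurableSpace X] (μ : Measure X) [IsProbabilityMeasure μ] {φ : κ → ι}
    (hφ : Function.Injective φ) :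
    MeasurePreserving (fun x : ι → X => x ∘ φ) (Measure.pi fun _ => μ)
      (Measure.pi fun _ => μ) := by
  refine ⟨measurable_pi_lambda _ fun k => measurable_pi_apply _, ?_⟩
  have h : iIndepFun (fun (i : ι) (x : ι → X) => x i) (Measure.pi fun _ => μ) :=
    iIndepFun_pi (X := fun _ => id) fun _ => aemeasurable_id
  have h' := (iIndepFun_iff_map_fun_eq_pi_map
    fun k => (measurable_pi_apply (φ k)).aemeasurable).1 (h.precomp hφ)
  simp_rw [(measurePreserving_eval (fun _ : ι => μ) _).map_eq] at h'
  exact h'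

/-- From an array of independent variables, selecting one entry in each column gives independent
variables. -/
lemma measurePreserving_select {ι κ X : Type*} [Fintype ι] [Fintype κ] [MeasurableSpace X]
    (μ : Measure X) [IsProbabilityMeasure μ] (s : κ → ι) :
    MeasurePreserving (fun (r : ι → κ → X) k => r (s k) k)
      (Measure.pi fun _ => Measure.pi fun _ => μ) (Measure.pi fun _ => μ) := by
  classical
  have hmeas : Measurable fun (r : ι → κ → X) k => r (s k) k :=
    measurable_pi_lambda _ fun k => (measurable_pi_apply k).comp (measurable_pi_apply (s k))
  refine ⟨hmeas, (Measure.pi_eq fun t ht => ?_).symm⟩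
  rw [Measure.map_apply hmeas (.univ_pi ht)]
  have hpre : (fun (r : ι → κ → X) k => r (s k) k) ⁻¹' Set.univ.pi t
      = Set.univ.pi fun i => Set.univ.pi fun k => if s k = i then t k else Set.univ := by
    ext r
    simp only [Set.mem_preimage, Set.mem_univ_pi]
    refine ⟨fun h i k => ?_, fun h k => by simpa using h (s k) k⟩
    split_ifs with hk
    · exact hk ▸ h k
    · trivial
  rw [hpre]
  simp_rw [Measure.pi_pi]
  -- Column by column, only the row `s k` contributes a factor other than `1`.
  rw [Finset.prod_comm]
  refine Finset.prod_congr rfl fun k _ => ?_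
  simp only [apply_ite μ, measure_univ]
  simp

end MeasureTheory

/-! ### The `W`-random graph as a function of independent vertex variables. -/

lemma ProbabilityTheory.map_lt_volume (p : unitInterval) :
    (volume : Measure unitInterval).map (fun r => r < p) = bernoulliMeasure True False p := by
  have hm : Measurable fun r : unitInterval => r < p := measurableSet_setOfPred.1 measurableSet_Iio
  have := Measure.isProbabilityMeasure_map (μ := (volume : Measure unitInterval)) hm.aemeasurable
  have hT : (volume : Measure unitInterval).map (fun r => r < p) {True}
      = bernoulliMeasure True False p {True} := by
    rw [Measure.map_apply hm (measurableSet_singleton _)]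
    have : (fun r => r < p) ⁻¹' {True} = Set.Iio p := by
      ext r; simp
    rw [this, unitInterval.volume_Iio, bernoulliMeasure_apply_of_mem_of_notMem _ (by simp) (by simp) (by simp)]
    rw [ENNReal.ofReal_eq_coe_nnreal p.2.1]
    rfl
  have hF : ({False} : Set Prop) = {True}ᶜ := by
    ext q; simp
  refine Measure.ext_of_singleton fun q => ?_
  by_cases hq : q
  · rw [eq_true hq, hT]
  · rw [eq_false hq, hF, prob_compl_eq_one_sub (measurableSet_singleton _),
      prob_compl_eq_one_sub (measurableSet_singleton _), hT]

namespace Graphon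

variable (W : Graphon) (n : ℕ)

/-- The graph built from latent variables `ω i = (u i, r i)`: the pair `e` is an edge when the coin
`r i e` of its larger endpoint `i` falls below the weight of `e`. -/
def latentGraph (ω : Fin n → unitInterval × (Sym2 (Fin n) → unitInterval)) :
    SimpleGraph (Fin n) :=
  SimpleGraph.fromEdgeSet {e | (ω e.sup).2 e < W.edgeWeight (fun i => (ω i).1) e}

/-- The law of the latent variables of a single vertex. -/
noncomputable abbrev vertexLaw : Measure (unitInterval × (Sym2 (Fin n) → unitInterval)) :=
  (volume : Measure unitInterval).prod (Measure.pi fun _ => volume)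

lemma measurable_coins : Measurable
    fun (p : (Fin n → unitInterval) × (Fin n → Sym2 (Fin n) → unitInterval)) (e : Sym2 (Fin n)) =>
      p.2 e.sup e < W.edgeWeight p.1 e := by
  refine measurable_pi_lambda _ fun e => measurableSet_setOfPred.1 (measurableSet_lt ?_ ?_)
  · exact (measurable_pi_apply e).comp ((measurable_pi_apply e.sup).comp measurable_snd)
  · exact (W.measurable_edgeWeight e).comp measurable_fst

lemma measurable_latentGraph : Measurable (W.latentGraph n) :=
  ((measurable_toGraph n).comp (W.measurable_coins n)).comp
    (MeasurableEquiv.arrowProdEquivProdArrow _ _ _).measurable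

/-- Each pair reads one coin from its own column of the array, so the coins read are independent and
uniform; comparing them with the edge weights yields the Bernoulli variables of `condLaw`. -/
lemma condLaw_eq_map (u : Fin n → unitInterval) :
    W.condLaw n u = (Measure.pi fun _ : Fin n => Measure.pi fun _ : Sym2 (Fin n) => volume).map
      fun r : Fin n → Sym2 (Fin n) → unitInterval => SimpleGraph.fromEdgeSet {e | r e.sup e < W.edgeWeight u e} := by
  have hlt (e : Sym2 (Fin n)) : Measurable fun r : unitInterval => r < W.edgeWeight u e :=
    measurableSet_setOfPred.1 measurableSet_Iio
  have hcoins : Measurable fun (r : Sym2 (Fin n) → unitInterval) e => r e < W.edgeWeight u e :=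
    measurable_pi_lambda _ fun e => (hlt e).comp (measurable_pi_apply e)
  have hsel := measurePreserving_select (volume : Measure unitInterval)
    (fun e : Sym2 (Fin n) => e.sup)
  have (e : Sym2 (Fin n)) := Measure.isProbabilityMeasure_map
    (μ := (volume : Measure unitInterval)) (hlt e).aemeasurable
  have hpi := Measure.pi_map_pi (μ := fun _ : Sym2 (Fin n) => (volume : Measure unitInterval))
    (f := fun e r => r < W.edgeWeight u e) fun e => (hlt e).aemeasurable
  simp_rw [map_lt_volume] at hpi
  calc W.condLaw n u
      = ((Measure.pi fun _ : Sym2 (Fin n) => volume).map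
          fun r e => r e < W.edgeWeight u e).map
          fun ω => SimpleGraph.fromEdgeSet {e | ω e} := by rw [condLaw, ← hpi]
    _ = _ := by
      conv_lhs => rw [← hsel.map_eq, Measure.map_map hcoins hsel.measurable,
        Measure.map_map (measurable_toGraph n) (hcoins.comp hsel.measurable)]
      rfl

lemma randomGraph_eq_map :
    W.randomGraph n = (Measure.pi fun _ : Fin n => vertexLaw n).map (W.latentGraph n) := by
  ext S hS
  have hmp := measurePreserving_arrowProdEquivProdArrow unitInterval
    (Sym2 (Fin n) → unitInterval) (Fin n) (fun _ => volume) (fun _ => Measure.pi fun _ => volume)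
  have hgm := (measurable_toGraph n).comp (W.measurable_coins n)
  rw [randomGraph, Measure.bind_apply hS (W.measurable_condLaw n).aemeasurable]
  have hmap : (Measure.pi fun _ : Fin n => vertexLaw n).map (W.latentGraph n)
      = ((Measure.pi fun _ : Fin n => (volume : Measure unitInterval)).prod
          (Measure.pi fun _ : Fin n => Measure.pi fun _ : Sym2 (Fin n) => volume)).map
        ((fun ω : Sym2 (Fin n) → Prop => SimpleGraph.fromEdgeSet {e | ω e}) ∘
          fun (p : (Fin n → unitInterval) × (Fin n → Sym2 (Fin n) → unitInterval))
            (e : Sym2 (Fin n)) => p.2 e.sup e < W.edgeWeight p.1 e) := by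
    rw [← hmp.map_eq, Measure.map_map hgm hmp.measurable]
    rfl
  rw [hmap, Measure.map_apply hgm hS, Measure.prod_apply (hgm hS)]
  refine lintegral_congr fun u => ?_
  rw [condLaw_eq_map]
  exact Measure.map_apply (hgm.comp (measurable_prodMk_left (x := u))) hS

/-- Graphs built from latent variables that differ at the vertex `i` only agree away from `i`. -/
lemma latentGraph_adj_congr {n : ℕ} {i : Fin n}
    {ω ω' : Fin n → unitInterval × (Sym2 (Fin n) → unitInterval)}
    (h : ∀ j, j ≠ i → ω j = ω' j) {a b : Fin n} (ha : a ≠ i) (hb : b ≠ i) :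
    (W.latentGraph n ω).Adj a b ↔ (W.latentGraph n ω').Adj a b := by
  -- The coin of the pair sits in the row of one of its endpoints, and neither is `i`.
  have hs : a ⊔ b ≠ i := by
    rcases max_choice a b with h | h <;> rw [h] <;> assumption
  simp only [latentGraph, SimpleGraph.fromEdgeSet_adj, Set.mem_ofPred_eq, Sym2.sup_mk, edgeWeight,
    Sym2.lift_mk, h a ha, h b hb, h _ hs]

end Graphon

/-! ### Counting vertex maps and the stability of homomorphism densities. -/

namespace SimpleGraph

instance {V : Type*} [Countable V] : MeasurableSingletonClass (SimpleGraph V) where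
  -- Together with finiteness, this makes every set of graphs on `Fin n` measurable.
  measurableSet_singleton G := by
    have h : ({G} : Set (SimpleGraph V)) = Adj ⁻¹' {G.Adj} := by
      ext H
      simp [SimpleGraph.adj_inj]
    rw [h]
    exact measurable_adj (measurableSet_singleton _)

variable {V V' : Type*} [Fintype V] [Fintype V']

open Classical in
/-- The vertex maps that are graph homomorphisms from `F` to `G`. -/
noncomputable def homFinset (F : SimpleGraph V) (G : SimpleGraph V') : Finset (V → V') :=
  {φ | ∀ a b, F.Adj a b → G.Adj (φ a) (φ b)}

lemma mem_homFinset {F : SimpleGraph V} {G : SimpleGraph V'} {φ : V → V'} :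
    φ ∈ F.homFinset G ↔ ∀ a b, F.Adj a b → G.Adj (φ a) (φ b) := by
  simp [homFinset]

lemma natCard_hom (F : SimpleGraph V) (G : SimpleGraph V') :
    Nat.card (F →g G) = (F.homFinset G).card := by
  let e : (F →g G) ≃ F.homFinset G :=
    { toFun := fun f => ⟨f, mem_homFinset.2 fun _ _ h => f.map_rel h⟩
      invFun := fun φ => ⟨φ.1, fun {a b} h => mem_homFinset.1 φ.2 a b h⟩
      left_inv := fun _ => rfl
      right_inv := fun _ => rfl }
  rw [Nat.card_congr e, Nat.card_eq_fintype_card, Fintype.card_coe]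

/-- Restriction to the complement of `v` loses nothing on `s`, which saves one factor in the count.
It serves both the maps hitting a fixed vertex and those identifying two given vertices. -/
lemma card_le_of_restrict_injOn [DecidableEq V] (v : V) (s : Finset (V → V'))
    (hs : ∀ φ ∈ s, ∀ ψ ∈ s, (∀ w, w ≠ v → φ w = ψ w) → φ v = ψ v) :
    s.card ≤ Fintype.card V' ^ (Fintype.card V - 1) := by
  have h : Set.InjOn (fun (φ : V → V') (w : {w // w ≠ v}) => φ w) s := by
    intro φ hφ ψ hψ h
    have hw (w : V) (hw : w ≠ v) : φ w = ψ w := congrFun h ⟨w, hw⟩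
    funext w
    by_cases hwv : w = v
    · exact hwv ▸ hs φ hφ ψ hψ hw
    · exact hw w hwv
  calc s.card ≤ (Finset.univ : Finset ({w // w ≠ v} → V')).card :=
        Finset.card_le_card_of_injOn _ (fun _ _ => Finset.mem_coe.2 (Finset.mem_univ _)) h
    _ = _ := by simp [Fintype.card_subtype_compl]

lemma card_filter_mem_range_le [DecidableEq V] [DecidableEq V'] (i : V') :
    (Finset.univ.filter fun φ : V → V' => ∃ v, φ v = i).card
      ≤ Fintype.card V * Fintype.card V' ^ (Fintype.card V - 1) := by
  calc _ ≤ (Finset.univ.biUnion fun v : V => Finset.univ.filter fun φ : V → V' => φ v = i).card :=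
        Finset.card_le_card fun φ hφ => by simpa using hφ
    _ ≤ ∑ v : V, (Finset.univ.filter fun φ : V → V' => φ v = i).card := Finset.card_biUnion_le
    _ ≤ ∑ _v : V, Fintype.card V' ^ (Fintype.card V - 1) :=
        Finset.sum_le_sum fun v _ => card_le_of_restrict_injOn v _ fun φ hφ ψ hψ _ => by
          rw [(Finset.mem_filter.1 hφ).2, (Finset.mem_filter.1 hψ).2]
    _ = _ := by simp

lemma card_filter_not_injective_le [DecidableEq V] [DecidableEq V'] :
    (Finset.univ.filter fun φ : V → V' => ¬ Function.Injective φ).card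
      ≤ Fintype.card V ^ 2 * Fintype.card V' ^ (Fintype.card V - 1) := by
  calc _ ≤ (Finset.univ.biUnion fun p : V × V =>
          Finset.univ.filter fun φ : V → V' => p.1 ≠ p.2 ∧ φ p.1 = φ p.2).card :=
        Finset.card_le_card fun φ hφ => by
          simp only [Finset.mem_filter, Finset.mem_univ, true_and, Finset.mem_biUnion,
            Prod.exists] at hφ ⊢
          simp only [Function.Injective, not_forall] at hφ
          obtain ⟨a, b, hab, hne⟩ := hφ
          exact ⟨a, b, hne, hab⟩
    _ ≤ ∑ p : V × V, (Finset.univ.filter fun φ : V → V' => p.1 ≠ p.2 ∧ φ p.1 = φ p.2).card :=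
        Finset.card_biUnion_le
    _ ≤ ∑ _p : V × V, Fintype.card V' ^ (Fintype.card V - 1) :=
        Finset.sum_le_sum fun p _ => card_le_of_restrict_injOn p.1 _ fun φ hφ ψ hψ h => by
          simp only [Finset.mem_filter, Finset.mem_univ, true_and] at hφ hψ
          rw [hφ.2, hψ.2, h _ hφ.1.symm]
    _ = _ := by simp [sq]

lemma homDensity_eq (F : SimpleGraph V) (G : SimpleGraph V') :
    homDensity F G = (F.homFinset G).card / (Fintype.card V' : ℝ) ^ Fintype.card V := by
  rw [homDensity, natCard_hom]

/-- Graphs that agree away from a vertex have close homomorphism densities. -/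
lemma homDensity_le_add_of_agree [Nonempty V] [Nonempty V'] (F : SimpleGraph V)
    {G G' : SimpleGraph V'} {i : V'} (h : ∀ a b, a ≠ i → b ≠ i → (G.Adj a b ↔ G'.Adj a b)) :
    homDensity F G ≤ homDensity F G' + Fintype.card V / Fintype.card V' := by
  classical
  have hsub : F.homFinset G ⊆ F.homFinset G' ∪
      Finset.univ.filter fun φ : V → V' => ∃ v, φ v = i := by
    intro φ hφ
    simp only [Finset.mem_union, Finset.mem_filter, Finset.mem_univ, true_and, mem_homFinset,
      or_iff_not_imp_right, not_exists] at hφ ⊢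
    exact fun hi a b hab => (h _ _ (hi a) (hi b)).1 (hφ a b hab)
  have hcard := (Finset.card_le_card hsub).trans ((Finset.card_union_le _ _).trans
    (Nat.add_le_add_left (card_filter_mem_range_le i) _))
  have hV' : (0 : ℝ) < Fintype.card V' := by exact_mod_cast Fintype.card_pos
  have hpow : (Fintype.card V' : ℝ) ^ Fintype.card V
      = Fintype.card V' ^ (Fintype.card V - 1) * Fintype.card V' := by
    rw [← pow_succ, Nat.sub_add_cancel Fintype.card_pos]
  have hfrac : (Fintype.card V : ℝ) / Fintype.card V'
      = Fintype.card V * Fintype.card V' ^ (Fintype.card V - 1)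
        / (Fintype.card V' : ℝ) ^ Fintype.card V := by
    rw [hpow]
    field_simp
  rw [homDensity_eq, homDensity_eq, hfrac, ← add_div]
  gcongr
  exact_mod_cast hcard

lemma abs_homDensity_sub_le_of_agree [Nonempty V] [Nonempty V'] (F : SimpleGraph V)
    {G G' : SimpleGraph V'} {i : V'} (h : ∀ a b, a ≠ i → b ≠ i → (G.Adj a b ↔ G'.Adj a b)) :
    |homDensity F G - homDensity F G'| ≤ Fintype.card V / Fintype.card V' := by
  have h1 := homDensity_le_add_of_agree F h
  have h2 := homDensity_le_add_of_agree F fun a b ha hb => (h a b ha hb).symm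
  exact abs_le.2 ⟨by linarith, by linarith⟩

end SimpleGraph

/-! ### Mean and concentration of the density of the random graph. -/

namespace Graphon

variable (W : Graphon) {n : ℕ} {V : Type*} [Fintype V]

lemma edgeWeight_map {κ ι : Type*} (u : ι → unitInterval) (φ : κ → ι) (e : Sym2 κ) :
    W.edgeWeight u (e.map φ) = W.edgeWeight (u ∘ φ) e := by
  induction e using Sym2.inductionOn with
  | hf a b => rfl

open Classical in
lemma condLaw_hom (F : SimpleGraph V) {φ : V → Fin n} (hφ : Function.Injective φ)
    (u : Fin n → unitInterval) :
    W.condLaw n u {G | φ ∈ F.homFinset G}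
      = ENNReal.ofReal (∏ e ∈ F.edgeFinset, (W.edgeWeight (u ∘ φ) e : ℝ)) := by
  have hpre : (fun ω : Sym2 (Fin n) → Prop => SimpleGraph.fromEdgeSet {e | ω e}) ⁻¹'
      {G | φ ∈ F.homFinset G} = Set.univ.pi fun e =>
        if e ∈ F.edgeFinset.image (Sym2.map φ) then {True} else Set.univ := by
    ext ω
    simp only [Set.mem_preimage, Set.mem_ofPred_eq, SimpleGraph.mem_homFinset, Set.mem_univ_pi,
      SimpleGraph.fromEdgeSet_adj]
    constructor
    · intro h e
      split_ifs with he
      · obtain ⟨e', he', rfl⟩ := Finset.mem_image.1 he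
        induction e' using Sym2.inductionOn with
        | hf a b => simpa using (h a b (by simpa using he')).1
      · trivial
    · intro h a b hab
      refine ⟨?_, fun heq => hab.ne (hφ heq)⟩
      have he : s(φ a, φ b) ∈ F.edgeFinset.image (Sym2.map φ) :=
        Finset.mem_image.2 ⟨s(a, b), by simpa using hab, rfl⟩
      have h' := h s(φ a, φ b)
      rw [if_pos he] at h'
      exact of_eq_true h'
  have hb (p : unitInterval) : bernoulliMeasure True False p {True} = ENNReal.ofReal p := by
    rw [bernoulliMeasure_apply_of_mem_of_notMem _ (by simp) (by simp) (by simp),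
      ENNReal.ofReal_eq_coe_nnreal p.2.1]
    rfl
  rw [condLaw, Measure.map_apply (measurable_toGraph n) (Set.toFinite _).measurableSet, hpre,
    Measure.pi_pi]
  have hterm (e : Sym2 (Fin n)) : bernoulliMeasure True False (W.edgeWeight u e)
      (if e ∈ F.edgeFinset.image (Sym2.map φ) then {True} else Set.univ)
      = if e ∈ F.edgeFinset.image (Sym2.map φ) then ENNReal.ofReal (W.edgeWeight u e) else 1 := by
    split_ifs
    · exact hb _
    · exact measure_univ
  simp_rw [hterm]
  -- Injectivity of `φ` keeps the images of distinct edges distinct, so each edge contributes its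
  -- own independent factor.
  rw [Finset.prod_ite_mem, Finset.univ_inter,
    Finset.prod_image fun _ _ _ _ h => Sym2.map.injective hφ h,
    ENNReal.ofReal_prod_of_nonneg fun e _ => (W.edgeWeight _ e).2.1]
  simp_rw [edgeWeight_map]

/-- For injective `φ` the points `u ∘ φ` are again i.i.d. uniform, so integrating the conditional
probability gives the density without error. -/
lemma randomGraph_real_hom (F : SimpleGraph V) {φ : V → Fin n} (hφ : Function.Injective φ) :
    (W.randomGraph n).real {G | φ ∈ F.homFinset G} = homDensity F W := by
  classical
  have hmeas : Measurable fun x : V → unitInterval =>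
      ∏ e ∈ F.edgeFinset, (W.edgeWeight x e : ℝ) :=
    Finset.measurable_prod _ fun e _ => measurable_subtype_coe.comp (W.measurable_edgeWeight e)
  have hmp := measurePreserving_comp_injective (volume : Measure unitInterval) hφ
  rw [measureReal_def, randomGraph, Measure.bind_apply (Set.toFinite _).measurableSet
    (W.measurable_condLaw n).aemeasurable]
  simp_rw [W.condLaw_hom F hφ]
  rw [hmp.lintegral_comp (f := fun x : V → unitInterval =>
    ENNReal.ofReal (∏ e ∈ F.edgeFinset, (W.edgeWeight x e : ℝ))) hmeas.ennreal_ofReal, homDensity,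
    integral_eq_lintegral_of_nonneg_ae
      (.of_forall fun x => Finset.prod_nonneg fun e _ => (W.edgeWeight x e).2.1)
      hmeas.aestronglyMeasurable]
  rfl

lemma homDensity_mem_Icc (F : SimpleGraph V) : homDensity F W ∈ Set.Icc (0 : ℝ) 1 := by
  classical
  have h0 (x : V → unitInterval) : 0 ≤ ∏ e ∈ F.edgeFinset, (W.edgeWeight x e : ℝ) :=
    Finset.prod_nonneg fun e _ => (W.edgeWeight x e).2.1
  have h1 (x : V → unitInterval) : ∏ e ∈ F.edgeFinset, (W.edgeWeight x e : ℝ) ≤ 1 :=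
    Finset.prod_le_one (fun e _ => (W.edgeWeight x e).2.1) fun e _ => (W.edgeWeight x e).2.2
  refine ⟨integral_nonneg h0, ?_⟩
  refine (integral_mono_of_nonneg (.of_forall h0) (integrable_const 1) (.of_forall h1)).trans ?_
  simp

open Classical in
lemma integral_homDensity (F : SimpleGraph V) :
    ∫ G, SimpleGraph.homDensity F G ∂(W.randomGraph n)
      = (∑ φ : V → Fin n, (W.randomGraph n).real {G | φ ∈ F.homFinset G})
        / (n : ℝ) ^ Fintype.card V := by
  have hind (φ : V → Fin n) (G : SimpleGraph (Fin n)) :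
      (if φ ∈ F.homFinset G then (1 : ℝ) else 0)
        = {G : SimpleGraph (Fin n) | φ ∈ F.homFinset G}.indicator (fun _ => 1) G := by
    simp [Set.indicator_apply]
  have hG (G : SimpleGraph (Fin n)) : SimpleGraph.homDensity F G
      = (∑ φ : V → Fin n, {G : SimpleGraph (Fin n) | φ ∈ F.homFinset G}.indicator
          (fun _ => (1 : ℝ)) G) / (n : ℝ) ^ Fintype.card V := by
    rw [SimpleGraph.homDensity_eq, Fintype.card_fin]
    simp_rw [← hind]
    simp
  simp_rw [hG]
  rw [integral_div, integral_finsetSum]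
  · congr 1
    refine Finset.sum_congr rfl fun φ _ => ?_
    rw [integral_indicator (Set.toFinite _).measurableSet]
    simp
  · intro φ _
    exact (integrable_const 1).indicator (Set.toFinite _).measurableSet

/-- The mean of the homomorphism density of the `W`-random graph is close to that of `W`, since
most vertex maps are injective. -/
lemma abs_integral_homDensity_sub_le [Nonempty V] (hn : 1 ≤ n) (F : SimpleGraph V) :
    |∫ G, SimpleGraph.homDensity F G ∂(W.randomGraph n) - homDensity F W|
      ≤ (Fintype.card V : ℝ) ^ 2 / n := by
  classical
  have hn0 : (0 : ℝ) < n := by exact_mod_cast hn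
  set t := homDensity F W with ht
  set p : (V → Fin n) → ℝ := fun φ => (W.randomGraph n).real {G | φ ∈ F.homFinset G} with hp
  have hpow : (n : ℝ) ^ Fintype.card V = n ^ (Fintype.card V - 1) * n := by
    rw [← pow_succ, Nat.sub_add_cancel Fintype.card_pos]
  have hdiff : ∫ G, SimpleGraph.homDensity F G ∂(W.randomGraph n) - t
      = (∑ φ : V → Fin n, (p φ - t)) / (n : ℝ) ^ Fintype.card V := by
    rw [integral_homDensity, Finset.sum_sub_distrib]
    simp only [Finset.sum_const, Finset.card_univ, Fintype.card_fun, Fintype.card_fin,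
      nsmul_eq_mul, Nat.cast_pow, hp]
    field_simp
  have hterm (φ : V → Fin n) : |p φ - t| ≤ if Function.Injective φ then 0 else 1 := by
    split_ifs with hφ
    · simp [hp, ht, W.randomGraph_real_hom F hφ]
    · have h1 := (W.homDensity_mem_Icc F)
      have h2 : 0 ≤ p φ := measureReal_nonneg
      have h3 : p φ ≤ 1 := measureReal_le_one
      exact abs_le.2 ⟨by linarith [h1.2], by linarith [h1.1]⟩
  have hsum : |∑ φ : V → Fin n, (p φ - t)|
      ≤ (Fintype.card V : ℝ) ^ 2 * n ^ (Fintype.card V - 1) := by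
    calc _ ≤ ∑ φ : V → Fin n, |p φ - t| := Finset.abs_sum_le_sum_abs _ _
      _ ≤ ∑ φ : V → Fin n, if Function.Injective φ then (0 : ℝ) else 1 :=
          Finset.sum_le_sum fun φ _ => hterm φ
      _ = ((Finset.univ.filter fun φ : V → Fin n => ¬ Function.Injective φ).card : ℝ) := by
          simp_rw [← ite_not (Function.Injective _)]
          rw [Finset.sum_boole]
      _ ≤ _ := by
          have h := SimpleGraph.card_filter_not_injective_le (V := V) (V' := Fin n)
          rw [Fintype.card_fin] at h
          exact_mod_cast h
  rw [hdiff, abs_div, abs_of_pos (by positivity : (0 : ℝ) < (n : ℝ) ^ Fintype.card V),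
    div_le_div_iff₀ (by positivity) hn0, hpow]
  calc _ ≤ (Fintype.card V : ℝ) ^ 2 * n ^ (Fintype.card V - 1) * n := by gcongr
    _ = _ := by ring

/-- Concentration of the homomorphism density of the `W`-random graph about its mean. -/
lemma randomGraph_real_abs_sub_integral_ge_le [Nonempty V] (hn : 1 ≤ n) (F : SimpleGraph V) {δ : ℝ}
    (hδ : 0 ≤ δ) :
    (W.randomGraph n).real {G | δ ≤ |SimpleGraph.homDensity F G
        - ∫ H, SimpleGraph.homDensity F H ∂(W.randomGraph n)|}
      ≤ 2 * Real.exp (-(2 * δ ^ 2 * n / (Fintype.card V : ℝ) ^ 2)) := by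
  have : NeZero n := ⟨by omega⟩
  have hn0 : (0 : ℝ) < n := by exact_mod_cast hn
  have hk0 : (0 : ℝ) < Fintype.card V := by exact_mod_cast Fintype.card_pos
  have hdm : Measurable fun G : SimpleGraph (Fin n) => SimpleGraph.homDensity F G :=
    measurable_of_finite _
  have hlm := W.measurable_latentGraph n
  -- With `c = k / n`, the quantity `n * c ^ 2` in McDiarmid's exponent is `k ^ 2 / n`.
  have hbd : HasBoundedDifferences (fun ω => SimpleGraph.homDensity F (W.latentGraph n ω))
      ((Fintype.card V : NNReal) / n) := by
    intro i ω ω' h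
    simpa using SimpleGraph.abs_homDensity_sub_le_of_agree F
      fun a b ha hb => W.latentGraph_adj_congr h ha hb
  have key := hbd.measureReal_abs_sub_integral_ge_le (μ := vertexLaw n) (hdm.comp hlm) hδ
  rw [randomGraph_eq_map, integral_map hlm.aemeasurable hdm.aestronglyMeasurable,
    map_measureReal_apply hlm (Set.toFinite _).measurableSet]
  refine key.trans_eq ?_
  congr 3
  push_cast
  field_simp

end Graphon

theorem theorem2 (W_G W_H : Graphon) (lam : unitInterval) {V : Type*} [Fintype V] [Nonempty V]
    (F : SimpleGraph V) (n : ℕ) (hn : 1 ≤ n) (ε : ℝ) (hε0 : 0 < ε) (hε1 : ε < 1) :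
    ((Graphon.mix lam W_G W_H).randomGraph n).real
        {G : SimpleGraph (Fin n) |
          |SimpleGraph.homDensity F G - Graphon.homDensity F (Graphon.mix lam W_G W_H)| > ε}
      ≤ 2 * Real.exp (-(ε ^ 2 * n / (8 * (Fintype.card V : ℝ) ^ 2))) := by
  set W := Graphon.mix lam W_G W_H
  have hn0 : (0 : ℝ) < n := by exact_mod_cast hn
  have hk0 : (0 : ℝ) < Fintype.card V := by exact_mod_cast Fintype.card_pos
  set k : ℝ := (Fintype.card V : ℝ)
  -- The threshold is where the bias bound `k ^ 2 / n` equals `ε / 2`. Below it the exponent is at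
  -- least `-1 / 4`, and `2 * exp (-1 / 4) ≥ 2 * (3 / 4) > 1`.
  rcases le_or_gt (ε * n) (2 * k ^ 2) with hsmall | hlarge
  · have hexp : ε ^ 2 * n / (8 * k ^ 2) ≤ 1 / 4 := by
      rw [div_le_iff₀ (by positivity)]
      nlinarith [mul_le_mul_of_nonneg_left hsmall hε0.le, sq_nonneg k]
    have h1 := Real.add_one_le_exp (-(ε ^ 2 * n / (8 * k ^ 2)))
    have h2 : (W.randomGraph n).real {G : SimpleGraph (Fin n) |
        |SimpleGraph.homDensity F G - Graphon.homDensity F W| > ε} ≤ 1 := measureReal_le_one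
    linarith
  · have hmean := W.abs_integral_homDensity_sub_le hn F
    have hhalf : k ^ 2 / n ≤ ε / 2 := by
      rw [div_le_iff₀ hn0]
      linarith
    have hsub : {G : SimpleGraph (Fin n) |
        |SimpleGraph.homDensity F G - Graphon.homDensity F W| > ε} ⊆
        {G | ε / 2 ≤ |SimpleGraph.homDensity F G
          - ∫ H, SimpleGraph.homDensity F H ∂(W.randomGraph n)|} := by
      intro G (hG : _ > ε)
      have h := abs_sub_le (SimpleGraph.homDensity F G)
        (∫ H, SimpleGraph.homDensity F H ∂(W.randomGraph n)) (Graphon.homDensity F W)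
      rw [Set.mem_ofPred_eq]
      linarith
    refine (measureReal_mono hsub).trans
      ((W.randomGraph_real_abs_sub_integral_ge_le hn F (by positivity)).trans ?_)
    -- Deviation `ε / 2` gives the exponent `-ε ^ 2 * n / (2 * k ^ 2)`, stronger than the constant
    -- `8` requires.
    gcongr 2 * Real.exp (-?_)
    rw [div_le_div_iff₀ (by positivity) (by positivity)]
    have : 0 ≤ ε ^ 2 * n * k ^ 2 := by positivity
    linarith
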